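/- Let $G$ be a non-trivial finite group with $|G|=n$. The Cayley machine $\mathcal C(G)$ is the automaton with state set and alphabet $G$ which, in state $g_0$ on input $g$, outputs $g_0g$ and goes to state $g_0g$. Thus the state $g_0$ computes the permutation $\mathcal C_{g_0}$ of the set $G^*$ of finite words given by $\mathcal C_{g_0}(\emptyset)=\emptyset$ and $\mathcal C_{g_0}(gu)=(g_0g)\,\mathcal C_{g_0g}(u)$. Let $\Gamma=\mathcal G(\mathcal C(G))$ be the group of permutations of $G^*$ generated by the $\mathcal C_g$, $g\in G$, and let $S=\{\mathcal C_g^{\pm1}\mid g\in G\}\subseteq\Gamma$. Let $w$ be an infinite word over $G$, let $k\ge 0$, and let $P_k\le\Gamma$ be the stabilizer of the prefix of $w$ of length $k$. Let $M_k$ be the Markov operator of the random walk on the Schreier graph of $(\Gamma,P_k,S)$, whose vertices are the left cosets of $P_k$ and which has, for each $s\in S$ and each vertex $hP_k$, an edge from $hP_k$ to $shP_k$; that is, $M_k:\ell^2(\Gamma/P_k)\to\ell^2(\Gamma/P_k)$ (over $\mathbb R$; $\Gamma/P_k$ is finite) is $$M_kf(hP_k)=\frac1{|S|}\sum_{s\in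 S}f(shP_k).$$ Then the spectrum of $M_k$ is $$\{1\}\cup\Big\{\cos\tfrac{p\pi}{q}\;\Big|\;q\in\{2,\dots,k+1\},\ 1\le p<q\Big\}.$$ The eigenvalue $1$ has multiplicity $1$. For all integers $1\le p<q$ with $p$ and $q$ coprime, the multiplicity of $\cos\frac{p\pi}{q}$ as an eigenvalue of $M_k$ (the dimension of $\ker(M_k-\cos\frac{p\pi}{q})$, which is $0$ when $\cos\frac{p\pi}{q}$ is not an eigenvalue) is $$\begin{cases} n-1 & \text{if } q=k+1,\\[4pt] n^k(n-1)^2\left(\dfrac{1-n^{-q(\lfloor k/q\rfloor+1)}}{1-n^{-q}}-1\right)+(n-1)\,\chi(q) & \text{otherwise,}\end{cases}$$ where $\chi(q)=1$ if $q$ divides $k+1$ and $\chi(q)=0$ otherwise. -/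

import Mathlib

/-- A (Mealy) automaton with state set `Q` and alphabet `A`:
`next q a` is `δ(q,a)` and `out q a` is `λ(q,a)`. -/
structure MealyAutomaton (Q A : Type*) where
  /-- the transition function -/
  next : Q → A → Q
  /-- the output function -/
  out : Q → A → A

namespace MealyAutomaton

variable {Q A : Type*}

/-- The transformation `𝒜_q` of the free monoid `A^*` computed by the automaton
started in state `q`: `q ∘ (a u) = (q ∘ a) ((q a) ∘ u)`. -/
def run (M : MealyAutomaton Q A) : Q → List A → List A
  | _, [] => []
  | q, a :: u => M.out q a :: M.run (M.next q a) u

/-- Each state function `λ_q : A → A` is a permutation. -/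
def IsInvertible (M : MealyAutomaton Q A) : Prop :=
  ∀ q, Function.Bijective (M.out q)

theorem length_run (M : MealyAutomaton Q A) (q : Q) (u : List A) :
    (M.run q u).length = u.length := by
  induction u generalizing q with
  | nil => rfl
  | cons a u ih => simp [run, ih]

theorem run_bijective (M : MealyAutomaton Q A) (h : M.IsInvertible) (q : Q) :
    Function.Bijective (M.run q) := by
  constructor
  · intro u
    induction u generalizing q with
    | nil =>
      intro v huv
      cases v with
      | nil => rfl
      | cons b v => simp [run] at huv
    | cons a u ih =>
      intro v huv
      cases v with
      | nil => simp [run] at huv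
      | cons b v =>
        simp only [run, List.cons.injEq] at huv
        obtain rfl := (h q).1 huv.1
        rw [ih _ huv.2]
  · intro v
    induction v generalizing q with
    | nil => exact ⟨[], rfl⟩
    | cons b v ih =>
      obtain ⟨a, ha⟩ := (h q).2 b
      obtain ⟨u, hu⟩ := ih (M.next q a)
      exact ⟨a :: u, by simp [run, ha, hu]⟩

/-- `𝒜_q` as a permutation of `A^*`, for an invertible automaton. -/
noncomputable def perm (M : MealyAutomaton Q A) (h : M.IsInvertible) (q : Q) :
    Equiv.Perm (List A) :=
  Equiv.ofBijective (M.run q) (M.run_bijective h q)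

/-- The automata group `𝒢(𝒜)`: the group generated by the `𝒜_q`. It acts on `A^*`
(the vertices of the rooted tree) as a group of permutations. -/
noncomputable def automataGroup (M : MealyAutomaton Q A) (h : M.IsInvertible) :
    Subgroup (Equiv.Perm (List A)) :=
  Subgroup.closure (Set.range (M.perm h))

/-- `𝒜_q` as an element of `𝒢(𝒜)`. -/
noncomputable def gen (M : MealyAutomaton Q A) (h : M.IsInvertible) (q : Q) :
    M.automataGroup h :=
  ⟨M.perm h q, Subgroup.subset_closure ⟨q, rfl⟩⟩

/-- The symmetric generating set of `𝒢(𝒜)` consisting of the `𝒜_q` and their inverses. -/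
def symmGens (M : MealyAutomaton Q A) (h : M.IsInvertible) : Set (M.automataGroup h) :=
  Set.range (M.gen h) ∪ Set.range (fun q => (M.gen h q)⁻¹)

instance finite_symmGens [Finite Q] (M : MealyAutomaton Q A) (h : M.IsInvertible) :
    Finite (M.symmGens h) :=
  ((Set.finite_range _).union (Set.finite_range _)).to_subtype

theorem length_smul (M : MealyAutomaton Q A) (h : M.IsInvertible) (γ : M.automataGroup h)
    (u : List A) : (γ • u).length = u.length := by
  obtain ⟨σ, hσ⟩ := γ
  change (σ u).length = u.length
  induction hσ using Subgroup.closure_induction generalizing u with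
  | mem x hx =>
    obtain ⟨q, rfl⟩ := hx
    exact M.length_run q u
  | one => rfl
  | mul x y _ _ hx hy => rw [Equiv.Perm.mul_apply, hx, hy]
  | inv x _ hx => rw [← hx (x⁻¹ u), ← Equiv.Perm.mul_apply, mul_inv_cancel, Equiv.Perm.one_apply]

/-- The stabilizer `P_k` in `𝒢(𝒜)` of the prefix `w_k` of length `k` of the infinite
word `w`. -/
noncomputable def prefixStabilizer (M : MealyAutomaton Q A) (h : M.IsInvertible)
    (w : ℕ → A) (k : ℕ) : Subgroup (M.automataGroup h) :=
  MulAction.stabilizer (M.automataGroup h) (List.ofFn fun i : Fin k => w i)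

instance finite_quotient_prefixStabilizer [Finite A] (M : MealyAutomaton Q A)
    (h : M.IsInvertible) (w : ℕ → A) (k : ℕ) :
    Finite (M.automataGroup h ⧸ M.prefixStabilizer h w k) := by
  have hfin : (MulAction.orbit (M.automataGroup h) (List.ofFn fun i : Fin k => w i)).Finite := by
    refine (List.finite_length_eq A k).subset ?_
    rintro _ ⟨γ, rfl⟩
    simp [length_smul]
  have := hfin.to_subtype
  exact Finite.of_equiv _ (MulAction.orbitEquivQuotientStabilizer (M.automataGroup h)
    (List.ofFn fun i : Fin k => w i))

end MealyAutomaton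

/-- The Cayley machine `𝒞(G)`: in state `g₀` on input `g` it goes to state `g₀ g` and
outputs `g₀ g`. -/
def cayleyMachine (G : Type*) [Group G] : MealyAutomaton G G where
  next g₀ g := g₀ * g
  out g₀ g := g₀ * g

theorem cayleyMachine_isInvertible (G : Type*) [Group G] : (cayleyMachine G).IsInvertible :=
  fun g => Group.mulLeft_bijective g

/-- The reset automaton `𝒜(G)`: in state `g₀` on input `g` it goes to state `g` and
outputs `g₀⁻¹ g`. -/
def resetAutomaton (G : Type*) [Group G] : MealyAutomaton G G where
  next _ g := g
  out g₀ g := g₀⁻¹ * g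

/-- The states of `𝒜(G)` compute the inverses of the states of `𝒞(G)`; hence both automata
have the same automata group and the same symmetric generating set. -/
theorem cayleyMachine_perm_inv_apply (G : Type*) [Group G] (g : G) (u : List G) :
    ((cayleyMachine G).perm (cayleyMachine_isInvertible G) g)⁻¹ u =
      (resetAutomaton G).run g u := by
  rw [Equiv.Perm.inv_eq_iff_eq]
  change u = (cayleyMachine G).run g _
  induction u generalizing g with
  | nil => rfl
  | cons a u ih =>
    simp only [MealyAutomaton.run, cayleyMachine, resetAutomaton, mul_inv_cancel_left,
      List.cons.injEq, true_and]
    exact ih a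

/-- A graph, with multiple edges and loops allowed, with vertex set `V`, each `e : E`
being an edge seen from its end `src e`, with `tgt e` at its other end. -/
structure EdgeGraph (V E : Type*) where
  /-- the vertex from which the edge is seen -/
  src : E → V
  /-- the vertex at the other end of the edge -/
  tgt : E → V

/-- The random walk (Markov) operator of a finite graph on `ℓ²(V) = ℝ^V`:
`(M f)(v)` is the average of `f` over the other ends of the edges at `v`. -/
noncomputable def EdgeGraph.markov {V E : Type*} [Finite V] [Finite E] (X : EdgeGraph V E) :
    Module.End ℝ (V → ℝ) where
  toFun f v := (Nat.card {e : E // X.src e = v} : ℝ)⁻¹ *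
    ∑ᶠ e : {e : E // X.src e = v}, f (X.tgt e)
  map_add' f g := by
    funext v
    simp only [Pi.add_apply]
    rw [finsum_add_distrib (Set.toFinite _) (Set.toFinite _), mul_add]
  map_smul' c f := by
    funext v
    simp only [Pi.smul_apply, smul_eq_mul, RingHom.id_apply]
    rw [← mul_finsum]
    ring

/-- The left Schreier graph `Sch Γ P S`: its vertices are the left cosets of `P`, its edge set
is `S × Γ/P`, and the edge `(s, gP)` goes from `gP` to `sgP`. -/
def schreierGraph {Γ : Type*} [Group Γ] (P : Subgroup Γ) (S : Set Γ) :
    EdgeGraph (Γ ⧸ P) (S × (Γ ⧸ P)) where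
  src e := e.2
  tgt e := (e.1 : Γ) • e.2

theorem markov_schreierGraph_apply {Γ : Type*} [Group Γ] (P : Subgroup Γ) (S : Set Γ)
    [Finite (Γ ⧸ P)] [Finite S] (f : Γ ⧸ P → ℝ) (v : Γ ⧸ P) :
    (schreierGraph P S).markov f v = (Nat.card S : ℝ)⁻¹ * ∑ᶠ s : S, f ((s : Γ) • v) := by
  let φ : S ≃ {e : S × (Γ ⧸ P) // (schreierGraph P S).src e = v} :=
    { toFun := fun s => ⟨(s, v), rfl⟩
      invFun := fun e => e.1.1
      left_inv := fun _ => rfl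
      right_inv := by rintro ⟨⟨s, u⟩, rfl⟩; rfl }
  change (Nat.card {e : S × (Γ ⧸ P) // (schreierGraph P S).src e = v} : ℝ)⁻¹ * _ = _
  rw [Nat.card_congr φ, ← finsum_comp_equiv φ]
  rfl

/-- The Markov operator `M_k` of the Schreier graph `Sch Γ P_k S`, where `Γ = 𝒢(𝒞(G))`,
`S` consists of the states of `𝒞(G)` and their inverses, and `P_k` is the stabilizer of the
prefix of length `k` of `w`. -/
noncomputable def cayleyMarkov (G : Type*) [Group G] [Finite G] (w : ℕ → G) (k : ℕ) :
    Module.End ℝ (((cayleyMachine G).automataGroup (cayleyMachine_isInvertible G) ⧸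
      (cayleyMachine G).prefixStabilizer (cayleyMachine_isInvertible G) w k) → ℝ) :=
  (schreierGraph ((cayleyMachine G).prefixStabilizer (cayleyMachine_isInvertible G) w k)
    ((cayleyMachine G).symmGens (cayleyMachine_isInvertible G))).markov

/-!
The automaton group acts transitively on the words of each length, so the vertices of the Schreier
graph are the words of length `k` (`exists_smul_eq_of_length_eq`, `word`), and the states and their
inverses are `2 n` different elements (`sumEquivSymmGens`). The Markov operator therefore becomes
the operator `walk` on functions of words.

Two maps shorten a word `x l`: dropping its first letter, and replacing it by the word of its
successive quotients, which is the output of the reset automaton (the inverse of the Cayley machine)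
on `l` in state `x`. Let `a` and `b` be composition with these two maps, and `a'` and `b'` the
averages over their fibres. On functions of mean zero `a' a = b' b = 1`, each of `a`, `a'` commutes
with each of `b`, `b'`, and the Markov operator is half of `b a' + a b'` (`shifts`,
`two_smul_walk`).

For such a pair of doubly commuting shifts, the space splits into chains
`a^r F, b a^(r-1) F, …, b^r F`, where `F` is primitive, that is, killed by `a'` and `b'`. The
operator `b a' + a b'` acts on a chain of length `r + 1` as the adjacency operator of a path, whose
eigenvalues `2 λ` are given by the zeros `λ` of the Chebyshev polynomial `U (r + 1)`. Hence the
multiplicity of `λ` on words of length `k` is the sum of the dimensions of the spaces of primitive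
vectors of degree `k - r` over the `r < k` with `U (r + 1)` vanishing at `λ`
(`DoublyCommutingShifts.finrank_eigen`). These dimensions are `n - 1` in degree `1` and
`n ^ j * (n - 1) ^ 2` in degree `j + 2`, by rank-nullity for `a'` and then for `b'`. As
`U (r + 1)` vanishes at `cos (p π / q)`, for `p` and `q` coprime, exactly if `q ∣ r + 2`, the
multiplicity is a geometric sum (`sum_finrank_prim`). Together with the functions of mean zero, the
constants fill the space; they account for the eigenvalue `1`, at which no `U m` with `m ≥ 1`
vanishes.
-/

/-! ### Graded pairs of doubly commuting shifts -/

/-- Two injective operators `a`, `b` of degree `1` on a graded space, with left inverses `a'`, `b'`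
of degree `-1`, such that each of `a`, `a'` commutes with each of `b`, `b'`. The space need not be
the sum of its graded pieces `gr k`, which are finite dimensional and begin with `gr 0 = 0`. -/
structure DoublyCommutingShifts (K H : Type*) [Field K] [AddCommGroup H] [Module K H] where
  /-- the first shift -/
  a : Module.End K H
  /-- the second shift -/
  b : Module.End K H
  /-- a left inverse of the first shift -/
  a' : Module.End K H
  /-- a left inverse of the second shift -/
  b' : Module.End K H
  a'_mul_a : a' * a = 1
  b'_mul_b : b' * b = 1
  comm_a_b : Commute a b
  comm_a'_b' : Commute a' b'
  comm_a'_b : Commute a' b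
  comm_a_b' : Commute a b'
  /-- the graded pieces -/
  gr : ℕ → Submodule K H
  gr_zero : gr 0 = ⊥
  a_mem : ∀ {k f}, f ∈ gr k → a f ∈ gr (k + 1)
  b_mem : ∀ {k f}, f ∈ gr k → b f ∈ gr (k + 1)
  a'_mem : ∀ {k f}, f ∈ gr (k + 1) → a' f ∈ gr k
  b'_mem : ∀ {k f}, f ∈ gr (k + 1) → b' f ∈ gr k
  finite : ∀ k, FiniteDimensional K (gr k)

namespace DoublyCommutingShifts

open Polynomial.Chebyshev

variable {K H : Type*} [Field K] [AddCommGroup H] [Module K H] (D : DoublyCommutingShifts K H)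

/-- The operator `b a' + a b'`, which moves one step up or down along each chain
`a^r F, b a^(r-1) F, …, b^r F` that starts from a primitive vector `F`. -/
def hop : Module.End K H := D.b * D.a' + D.a * D.b'

/-- The primitive vectors of degree `j`: those killed by `a'` and by `b'`. -/
def prim (j : ℕ) : Submodule K H :=
  (D.gr j ⊓ LinearMap.ker D.a') ⊓ LinearMap.ker D.b'

/-- The projection onto the vectors killed by `a'` and by `b'`, along `im a + im b`. -/
def proj : Module.End K H := (1 - D.a * D.a') * (1 - D.b * D.b')

/-- The coordinate of a vector along `b^i a^l` (primitive vectors). -/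
def coord (i l : ℕ) : Module.End K H := D.proj * D.b' ^ i * D.a' ^ l

theorem mem_prim {j : ℕ} {F : H} : F ∈ D.prim j ↔ F ∈ D.gr j ∧ D.a' F = 0 ∧ D.b' F = 0 := by
  simp [prim, and_assoc]

instance (j : ℕ) : FiniteDimensional K (D.gr j) := D.finite j

instance (j : ℕ) : FiniteDimensional K (D.prim j) :=
  Submodule.finiteDimensional_of_le (inf_le_left.trans inf_le_left : D.prim j ≤ D.gr j)

theorem proj_mul_a : D.proj * D.a = 0 := by
  have h : (1 - D.b * D.b') * D.a = D.a * (1 - D.b * D.b') := by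
    rw [sub_mul, mul_sub, one_mul, mul_one, mul_assoc, ← D.comm_a_b'.eq, ← mul_assoc,
      ← D.comm_a_b.eq, mul_assoc]
  rw [proj, mul_assoc, h, ← mul_assoc, sub_mul, mul_assoc D.a, D.a'_mul_a, one_mul, mul_one,
    sub_self, zero_mul]

theorem proj_mul_b : D.proj * D.b = 0 := by
  have h : (1 - D.b * D.b') * D.b = 0 := by
    rw [sub_mul, mul_assoc, D.b'_mul_b, one_mul, mul_one, sub_self]
  rw [proj, mul_assoc, h, mul_zero]

theorem pow_a'_mul_pow_a (m : ℕ) : D.a' ^ m * D.a ^ m = 1 := by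
  induction m with
  | zero => simp
  | succ m ih =>
    rw [pow_succ D.a', pow_succ' D.a, mul_assoc, ← mul_assoc D.a', D.a'_mul_a, one_mul, ih]

theorem a'_mul_proj : D.a' * D.proj = 0 := by
  have h : D.a' * (1 - D.a * D.a') = 0 := by
    rw [mul_sub, ← mul_assoc, D.a'_mul_a, one_mul, mul_one, sub_self]
  rw [proj, ← mul_assoc, h, zero_mul]

theorem b'_mul_proj : D.b' * D.proj = 0 := by
  have h : D.b' * (1 - D.a * D.a') = (1 - D.a * D.a') * D.b' := by
    rw [sub_mul, mul_sub, one_mul, mul_one, mul_assoc, D.comm_a'_b'.eq, ← mul_assoc,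
      ← D.comm_a_b'.eq, mul_assoc]
  rw [proj, ← mul_assoc, h, mul_assoc, mul_sub, ← mul_assoc D.b', D.b'_mul_b, one_mul, mul_one,
    sub_self, mul_zero]

theorem proj_apply_of_killed {F : H} (ha : D.a' F = 0) (hb : D.b' F = 0) : D.proj F = F := by
  simp [proj, ha, hb]

theorem pow_a_mem {k : ℕ} {f : H} (hf : f ∈ D.gr k) (l : ℕ) : (D.a ^ l) f ∈ D.gr (k + l) := by
  induction l with
  | zero => simpa using hf
  | succ l ih => rw [pow_succ', Module.End.mul_apply]; exact D.a_mem ih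

theorem pow_b_mem {k : ℕ} {f : H} (hf : f ∈ D.gr k) (l : ℕ) : (D.b ^ l) f ∈ D.gr (k + l) := by
  induction l with
  | zero => simpa using hf
  | succ l ih => rw [pow_succ', Module.End.mul_apply]; exact D.b_mem ih

theorem pow_a'_mem {k : ℕ} {f : H} (l : ℕ) (hf : f ∈ D.gr (k + l)) : (D.a' ^ l) f ∈ D.gr k := by
  induction l generalizing f with
  | zero => simpa using hf
  | succ l ih => rw [pow_succ, Module.End.mul_apply]; exact ih (D.a'_mem hf)

theorem proj_mem {k : ℕ} {f : H} (hf : f ∈ D.gr k) : D.proj f ∈ D.gr k := by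
  have key : ∀ {g}, g ∈ D.gr k → g - D.b (D.b' g) ∈ D.gr k ∧ g - D.a (D.a' g) ∈ D.gr k := by
    intro g hg
    cases k with
    | zero =>
      obtain rfl : g = 0 := by simpa [D.gr_zero] using hg
      simp
    | succ k =>
      exact ⟨sub_mem hg (D.b_mem (D.b'_mem hg)), sub_mem hg (D.a_mem (D.a'_mem hg))⟩
  exact (key (key hf).1).2

/-- A vector of the `k`-th graded piece is determined by its coordinates. -/
theorem eq_zero_of_coord_eq_zero {k : ℕ} {f : H} (hf : f ∈ D.gr k)
    (h : ∀ i l, D.coord i l f = 0) : f = 0 := by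
  induction k generalizing f with
  | zero => simpa [D.gr_zero] using hf
  | succ k ih =>
    have ha : D.a' f = 0 := ih (D.a'_mem hf) fun i l => by
      rw [← h i (l + 1), coord, coord, pow_succ, ← mul_assoc, Module.End.mul_apply (_ * _) D.a']
    have hb : D.b' f = 0 := ih (D.b'_mem hf) fun i l => by
      rw [← h (i + 1) l, coord, coord, ← Module.End.mul_apply, mul_assoc (_ * _),
        (D.comm_a'_b'.pow_left l).eq, pow_succ]
      simp only [mul_assoc]
    simpa [coord, D.proj_apply_of_killed ha hb] using h 0 0

/-! ### Eigenvectors of the hopping operator -/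

theorem coord_mul_b_mul_a'_zero (l : ℕ) : D.coord 0 l * (D.b * D.a') = 0 := by
  rw [coord, pow_zero, mul_one, mul_assoc, ← mul_assoc (D.a' ^ l), (D.comm_a'_b.pow_left l).eq,
    mul_assoc, ← mul_assoc, D.proj_mul_b, zero_mul]

theorem coord_mul_b_mul_a'_succ (i l : ℕ) :
    D.coord (i + 1) l * (D.b * D.a') = D.coord i (l + 1) := by
  rw [coord, coord, mul_assoc, ← mul_assoc (D.a' ^ l), (D.comm_a'_b.pow_left l).eq, mul_assoc D.b,
    ← pow_succ, pow_succ D.b', ← mul_assoc D.proj, mul_assoc _ D.b', ← mul_assoc D.b', D.b'_mul_b,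
    one_mul]

theorem coord_mul_a_mul_b'_zero (i : ℕ) : D.coord i 0 * (D.a * D.b') = 0 := by
  rw [coord, pow_zero, mul_one, mul_assoc, ← mul_assoc (D.b' ^ i), ← (D.comm_a_b'.pow_right i).eq,
    mul_assoc, ← mul_assoc, D.proj_mul_a, zero_mul]

theorem coord_mul_a_mul_b'_succ (i l : ℕ) :
    D.coord i (l + 1) * (D.a * D.b') = D.coord (i + 1) l := by
  rw [coord, coord, pow_succ D.a', mul_assoc, mul_assoc, mul_assoc (D.a' ^ l), ← mul_assoc D.a',
    D.a'_mul_a, one_mul, (D.comm_a'_b'.pow_left l).eq, pow_succ, ← mul_assoc, ← mul_assoc,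
    mul_assoc D.proj]

variable {D} in
/-- The coordinates of an eigenvector satisfy the recursion of the Chebyshev polynomials. -/
theorem coord_eq_of_hop {lam : K} {f : H} (h : D.hop f = (2 * lam) • f) (i l : ℕ) :
    D.coord i l f = (U K i).eval lam • D.coord 0 (i + l) f := by
  have hc : ∀ i l, (D.coord i l * (D.b * D.a')) f + (D.coord i l * (D.a * D.b')) f =
      (2 * lam) • D.coord i l f := by
    intro i l
    rw [← map_smul, ← h, hop]
    simp
  induction i using Nat.twoStepInduction generalizing l with
  | zero => simp
  | one =>
    have := hc 0 l.succ
    rw [coord_mul_b_mul_a'_zero, Nat.succ_eq_add_one, coord_mul_a_mul_b'_succ,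
      LinearMap.zero_apply, zero_add] at this
    rw [this, add_comm 1 l]
    simp
  | more i ih0 ih1 =>
    have := hc (i + 1) (l + 1)
    rw [coord_mul_b_mul_a'_succ, coord_mul_a_mul_b'_succ, ih0, ih1,
      show i + 1 + (l + 1) = i + 2 + l by ring, show i + (l + 1 + 1) = i + 2 + l by ring] at this
    rw [eq_sub_of_add_eq' this, smul_smul, ← sub_smul]
    push_cast
    rw [U_add_two]
    simp

variable {D} in
/-- The boundary condition at the end of a chain. -/
theorem eval_U_smul_coord_eq_zero {lam : K} {f : H} (h : D.hop f = (2 * lam) • f) (r : ℕ) :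
    (U K ((r + 1 : ℕ) : ℤ)).eval lam • D.coord 0 r f = 0 := by
  have hc : (D.coord r 0 * (D.b * D.a')) f + (D.coord r 0 * (D.a * D.b')) f =
      (2 * lam) • D.coord r 0 f := by
    rw [← map_smul, ← h, hop]
    simp
  rw [coord_mul_a_mul_b'_zero, LinearMap.zero_apply, add_zero] at hc
  cases r with
  | zero =>
    rw [coord_mul_b_mul_a'_zero, LinearMap.zero_apply] at hc
    simpa using hc.symm
  | succ r =>
    rw [coord_mul_b_mul_a'_succ, coord_eq_of_hop h, coord_eq_of_hop h (r + 1) 0, smul_smul,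
      add_zero, ← sub_eq_zero, ← sub_smul] at hc
    rw [← neg_eq_zero, ← neg_smul, ← hc]
    push_cast
    rw [add_assoc, one_add_one_eq_two, U_add_two]
    simp

/-- The combination of the chain of length `r + 1` starting from `F` whose coefficients are the
values of the Chebyshev polynomials of the second kind at `lam`. -/
noncomputable def chainVec (lam : K) (r : ℕ) : Module.End K H :=
  ∑ i ∈ Finset.range (r + 1), (U K i).eval lam • (D.b ^ i * D.a ^ (r - i))

theorem chainVec_mem (lam : K) {r j : ℕ} {F : H} (hF : F ∈ D.gr j) :
    D.chainVec lam r F ∈ D.gr (j + r) := by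
  rw [chainVec, LinearMap.sum_apply]
  refine sum_mem fun i hi => ?_
  rw [LinearMap.smul_apply, Module.End.mul_apply]
  refine Submodule.smul_mem _ _ ?_
  have := D.pow_b_mem (D.pow_a_mem hF (r - i)) i
  rwa [add_assoc, Nat.sub_add_cancel (Nat.lt_succ_iff.1 (Finset.mem_range.1 hi))] at this

theorem hop_chainVec {lam : K} {r : ℕ} (hU : (U K ((r + 1 : ℕ) : ℤ)).eval lam = 0) {F : H}
    (ha : D.a' F = 0) (hb : D.b' F = 0) :
    D.hop (D.chainVec lam r F) = (2 * lam) • D.chainVec lam r F := by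
  have hba : ∀ i l, (D.b * D.a') ((D.b ^ i * D.a ^ (l + 1)) F) = (D.b ^ (i + 1) * D.a ^ l) F := by
    intro i l
    rw [← Module.End.mul_apply, mul_assoc, ← mul_assoc D.a', (D.comm_a'_b.pow_right i).eq,
      pow_succ' D.a, mul_assoc, ← mul_assoc D.a', D.a'_mul_a, one_mul, ← mul_assoc, ← pow_succ']
  have hba0 : ∀ i, (D.b * D.a') ((D.b ^ i * D.a ^ 0) F) = 0 := by
    intro i
    rw [← Module.End.mul_apply, pow_zero, mul_one, mul_assoc, (D.comm_a'_b.pow_right i).eq]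
    simp [ha]
  have hab : ∀ i l, (D.a * D.b') ((D.b ^ (i + 1) * D.a ^ l) F) = (D.b ^ i * D.a ^ (l + 1)) F := by
    intro i l
    rw [← Module.End.mul_apply, pow_succ' D.b, mul_assoc, mul_assoc D.b, ← mul_assoc D.b',
      D.b'_mul_b, one_mul, ← mul_assoc, (D.comm_a_b.pow_right i).eq, mul_assoc, ← pow_succ']
  have hab0 : ∀ l, (D.a * D.b') ((D.b ^ 0 * D.a ^ l) F) = 0 := by
    intro l
    rw [← Module.End.mul_apply, pow_zero, one_mul, mul_assoc, ← (D.comm_a_b'.pow_left l).eq]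
    simp [hb]
  -- Both halves of `hop` shift the index of the coefficient; `U (-1) = 0` and `U (r + 1) = 0`
  -- supply the missing end terms.
  have h1 : (D.b * D.a') (D.chainVec lam r F) = ∑ i ∈ Finset.range (r + 1),
      (U K ((i : ℤ) - 1)).eval lam • (D.b ^ i * D.a ^ (r - i)) F := by
    rw [chainVec, LinearMap.sum_apply, map_sum, Finset.sum_range_succ, Finset.sum_range_succ',
      Nat.sub_self]
    simp only [LinearMap.smul_apply, map_smul]
    rw [hba0]
    simp only [smul_zero, add_zero, Nat.cast_zero, zero_sub, U_neg_one, Polynomial.eval_zero,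
      zero_smul]
    refine Finset.sum_congr rfl fun i hi => ?_
    rw [show r - i = r - (i + 1) + 1 by have := Finset.mem_range.1 hi; omega, hba]
    simp
  have h2 : (D.a * D.b') (D.chainVec lam r F) = ∑ i ∈ Finset.range (r + 1),
      (U K ((i : ℤ) + 1)).eval lam • (D.b ^ i * D.a ^ (r - i)) F := by
    rw [chainVec, LinearMap.sum_apply, map_sum, Finset.sum_range_succ', Finset.sum_range_succ]
    simp only [LinearMap.smul_apply, map_smul]
    push_cast at hU
    rw [hab0, hU, zero_smul, smul_zero]
    simp only [add_zero]
    refine Finset.sum_congr rfl fun i hi => ?_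
    rw [hab, show r - i = r - (i + 1) + 1 by have := Finset.mem_range.1 hi; omega]
    push_cast
    rfl
  rw [hop, LinearMap.add_apply, h1, h2, ← Finset.sum_add_distrib, chainVec, LinearMap.sum_apply,
    Finset.smul_sum]
  refine Finset.sum_congr rfl fun i _ => ?_
  rw [← add_smul, LinearMap.smul_apply, smul_smul, U_add_one]
  simp

theorem coord_zero_mul_pow_b_succ (r i l : ℕ) :
    D.coord 0 r * (D.b ^ (i + 1) * D.a ^ l) = 0 := by
  rw [coord, pow_zero, mul_one, mul_assoc, ← mul_assoc (D.a' ^ r),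
    ((D.comm_a'_b.pow_left r).pow_right _).eq, pow_succ', mul_assoc, mul_assoc, ← mul_assoc,
    D.proj_mul_b, zero_mul]

theorem coord_zero_chainVec_self (lam : K) (r : ℕ) {F : H} (ha : D.a' F = 0) (hb : D.b' F = 0) :
    D.coord 0 r (D.chainVec lam r F) = F := by
  rw [chainVec, LinearMap.sum_apply, map_sum, Finset.sum_range_succ', Finset.sum_eq_zero]
  · rw [zero_add, LinearMap.smul_apply, map_smul, ← Module.End.mul_apply]
    simp [coord, mul_assoc, D.pow_a'_mul_pow_a, D.proj_apply_of_killed ha hb]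
  · intro i _
    rw [LinearMap.smul_apply, map_smul, ← Module.End.mul_apply, coord_zero_mul_pow_b_succ,
      LinearMap.zero_apply, smul_zero]

theorem coord_zero_chainVec_of_ne (lam : K) {r s : ℕ} (hrs : r ≠ s) {F : H} (ha : D.a' F = 0) :
    D.coord 0 s (D.chainVec lam r F) = 0 := by
  rw [chainVec, LinearMap.sum_apply, map_sum, Finset.sum_range_succ', Finset.sum_eq_zero]
  · rw [zero_add, LinearMap.smul_apply, map_smul, ← Module.End.mul_apply, coord, pow_zero, mul_one,
      pow_zero, one_mul, mul_assoc, Nat.sub_zero]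
    rcases hrs.lt_or_gt with hlt | hlt
    · obtain ⟨m, rfl⟩ := Nat.exists_eq_add_of_lt hlt
      rw [show r + m + 1 = (m + 1) + r by ring, pow_add D.a', mul_assoc, pow_a'_mul_pow_a, mul_one,
        pow_succ]
      simp [ha]
    · obtain ⟨m, rfl⟩ := Nat.exists_eq_add_of_lt hlt
      rw [add_assoc, pow_add D.a, ← mul_assoc (D.a' ^ s), pow_a'_mul_pow_a, one_mul, pow_succ',
        ← mul_assoc, D.proj_mul_a]
      simp
  · intro i _
    rw [LinearMap.smul_apply, map_smul, ← Module.End.mul_apply, coord_zero_mul_pow_b_succ,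
      LinearMap.zero_apply, smul_zero]

/-- The vectors of degree `k` on which `hop` is multiplication by `2 * lam`. -/
def eigen (k : ℕ) (lam : K) : Submodule K H :=
  D.gr k ⊓ LinearMap.ker (D.hop - (2 * lam) • (1 : Module.End K H))

theorem mem_eigen {k : ℕ} {lam : K} {f : H} :
    f ∈ D.eigen k lam ↔ f ∈ D.gr k ∧ D.hop f = (2 * lam) • f := by
  simp [eigen, sub_eq_zero]

theorem coord_zero_mem_prim {k r : ℕ} (hr : r < k) {f : H} (hf : f ∈ D.gr k) :
    D.coord 0 r f ∈ D.prim (k - r) := by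
  rw [mem_prim, coord, pow_zero, mul_one]
  refine ⟨D.proj_mem (D.pow_a'_mem r (by rwa [Nat.sub_add_cancel hr.le])), ?_, ?_⟩
  · rw [← Module.End.mul_apply, ← mul_assoc, D.a'_mul_proj]; simp
  · rw [← Module.End.mul_apply, ← mul_assoc, D.b'_mul_proj]; simp

/-- An eigenvector is determined by its coordinates along `a ^ r`, which may be arbitrary for those
`r` with `U (r + 1)` vanishing at the eigenvalue and are zero for the others. -/
theorem finrank_eigen [DecidableEq K] (k : ℕ) (lam : K) :
    Module.finrank K (D.eigen k lam) =
      ∑ r ∈ (Finset.range k).filter (fun r : ℕ => (U K ((r + 1 : ℕ) : ℤ)).eval lam = 0),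
        Module.finrank K (D.prim (k - r)) := by
  classical
  set R := (Finset.range k).filter (fun r : ℕ => (U K ((r + 1 : ℕ) : ℤ)).eval lam = 0) with hR
  have hlt : ∀ r : R, (r : ℕ) < k := fun r =>
    Finset.mem_range.1 (Finset.mem_filter.1 r.2).1
  have hU : ∀ r : R, (U K (((r : ℕ) + 1 : ℕ) : ℤ)).eval lam = 0 := fun r =>
    (Finset.mem_filter.1 r.2).2
  let Φ : D.eigen k lam →ₗ[K] ((r : R) → D.prim (k - r)) :=
    LinearMap.pi fun r => (D.coord 0 r).restrict
      (p := D.eigen k lam) (q := D.prim (k - r))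
      (fun f hf => D.coord_zero_mem_prim (hlt r) (D.mem_eigen.1 hf).1)
  have hΦ : ∀ f r, (Φ f r : H) = D.coord 0 r f := fun _ _ => rfl
  have hinj : Function.Injective Φ := by
    rw [← LinearMap.ker_eq_bot, LinearMap.ker_eq_bot']
    rintro ⟨f, hf⟩ h0
    obtain ⟨hgr, hhop⟩ := D.mem_eigen.1 hf
    have hz : ∀ r, D.coord 0 r f = 0 := by
      intro r
      by_cases hr : r < k
      · by_cases hu : (U K ((r + 1 : ℕ) : ℤ)).eval lam = 0
        · have := hΦ ⟨f, hf⟩ ⟨r, Finset.mem_filter.2 ⟨Finset.mem_range.2 hr, hu⟩⟩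
          rw [h0] at this
          exact this.symm
        · exact (smul_eq_zero.1 (eval_U_smul_coord_eq_zero hhop r)).resolve_left hu
      · obtain ⟨m, rfl⟩ := Nat.exists_eq_add_of_le (not_lt.1 hr)
        have : (D.a' ^ k) f = 0 := by
          simpa [D.gr_zero] using D.pow_a'_mem (k := 0) k (by simpa using hgr)
        rw [coord, add_comm k m, pow_add]
        simp [this]
    refine Subtype.ext (D.eq_zero_of_coord_eq_zero hgr fun i l => ?_)
    rw [coord_eq_of_hop hhop, hz, smul_zero]
  have hsurj : Function.Surjective Φ := by
    intro F
    have hp := fun r : R => D.mem_prim.1 (F r).2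
    refine ⟨⟨∑ r : R, D.chainVec lam r (F r), sum_mem fun r _ => ?_⟩, ?_⟩
    · rw [mem_eigen]
      refine ⟨?_, D.hop_chainVec (hU r) (hp r).2.1 (hp r).2.2⟩
      have := D.chainVec_mem lam (r := r) (hp r).1
      rwa [Nat.sub_add_cancel (hlt r).le] at this
    · funext s
      refine Subtype.ext ?_
      rw [hΦ]
      change D.coord 0 s (∑ r : R, D.chainVec lam r (F r)) = _
      rw [map_sum, Finset.sum_eq_single s]
      · exact D.coord_zero_chainVec_self lam s (hp s).2.1 (hp s).2.2
      · intro r _ hrs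
        exact D.coord_zero_chainVec_of_ne lam (fun h => hrs (Subtype.ext h)) (hp r).2.1
      · simp
  rw [(LinearEquiv.ofBijective Φ ⟨hinj, hsurj⟩).finrank_eq, Module.finrank_pi_fintype,
    Finset.sum_coe_sort R fun r => Module.finrank K (D.prim (k - r))]

/-! ### Dimensions of the spaces of primitive vectors -/

/-- Rank-nullity for a linear map taking `p` to `q` with a right inverse taking `q` to `p`. -/
theorem _root_.Submodule.finrank_inf_ker_add_finrank {H' : Type*} [AddCommGroup H'] [Module K H']
    {p : Submodule K H} {q : Submodule K H'} [FiniteDimensional K p] (f : H →ₗ[K] H')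
    (g : H' →ₗ[K] H) (hf : ∀ x ∈ p, f x ∈ q) (hg : ∀ x ∈ q, g x ∈ p)
    (hfg : ∀ x, f (g x) = x) :
    Module.finrank K (p ⊓ LinearMap.ker f : Submodule K H) + Module.finrank K q =
      Module.finrank K p := by
  have hsurj : LinearMap.range (f.restrict hf) = ⊤ := by
    rw [LinearMap.range_eq_top]
    rintro ⟨y, hy⟩
    exact ⟨⟨g y, hg y hy⟩, Subtype.ext (hfg y)⟩
  have hker : LinearMap.ker (f.restrict hf) = (LinearMap.ker f).comap p.subtype := by
    ext x
    simp [LinearMap.mem_ker, Subtype.ext_iff]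
  have := LinearMap.finrank_range_add_finrank_ker (f.restrict hf)
  rwa [hsurj, finrank_top, hker, ← Submodule.finrank_map_subtype_eq, Submodule.map_comap_subtype,
    add_comm] at this

theorem finrank_ker_a'_add_finrank_gr (j : ℕ) :
    Module.finrank K (D.gr (j + 1) ⊓ LinearMap.ker D.a' : Submodule K H) +
      Module.finrank K (D.gr j) = Module.finrank K (D.gr (j + 1)) :=
  Submodule.finrank_inf_ker_add_finrank D.a' D.a (fun _ => D.a'_mem) (fun _ => D.a_mem)
    fun x => by rw [← Module.End.mul_apply, D.a'_mul_a, Module.End.one_apply]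

/-- Since `b` and `b'` commute with `a'`, they restrict to its kernel. -/
theorem finrank_prim_add_finrank_ker_a' (j : ℕ) :
    Module.finrank K (D.prim (j + 1)) +
      Module.finrank K (D.gr j ⊓ LinearMap.ker D.a' : Submodule K H) =
      Module.finrank K (D.gr (j + 1) ⊓ LinearMap.ker D.a' : Submodule K H) := by
  have : FiniteDimensional K (D.gr (j + 1) ⊓ LinearMap.ker D.a' : Submodule K H) :=
    Submodule.finiteDimensional_of_le (inf_le_left : _ ≤ D.gr (j + 1))
  refine Submodule.finrank_inf_ker_add_finrank D.b' D.b (fun x hx => ?_) (fun x hx => ?_)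
    fun x => by rw [← Module.End.mul_apply, D.b'_mul_b, Module.End.one_apply]
  · refine ⟨D.b'_mem hx.1, ?_⟩
    rw [SetLike.mem_coe, LinearMap.mem_ker, ← Module.End.mul_apply, D.comm_a'_b'.eq,
      Module.End.mul_apply, LinearMap.mem_ker.1 hx.2, map_zero]
  · refine ⟨D.b_mem hx.1, ?_⟩
    rw [SetLike.mem_coe, LinearMap.mem_ker, ← Module.End.mul_apply, D.comm_a'_b.eq,
      Module.End.mul_apply, LinearMap.mem_ker.1 hx.2, map_zero]

variable {D} in
theorem finrank_ker_a'_of_finrank_gr {n : ℕ} (hn : ∀ k, Module.finrank K (D.gr k) + 1 = n ^ k)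
    (j : ℕ) : (Module.finrank K (D.gr (j + 1) ⊓ LinearMap.ker D.a' : Submodule K H) : ℝ) =
      (n : ℝ) ^ j * (n - 1) := by
  have h1 : ((Module.finrank K (D.gr j) + 1 : ℕ) : ℝ) = (n ^ j : ℕ) := by rw [hn]
  have h2 : ((Module.finrank K (D.gr (j + 1)) + 1 : ℕ) : ℝ) = (n ^ (j + 1) : ℕ) := by rw [hn]
  rw [← D.finrank_ker_a'_add_finrank_gr j] at h2
  push_cast at h1 h2
  rw [pow_succ] at h2
  linear_combination h2 - h1

variable {D} in
theorem finrank_prim_one {n : ℕ} (hn : ∀ k, Module.finrank K (D.gr k) + 1 = n ^ k) :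
    (Module.finrank K (D.prim 1) : ℝ) = n - 1 := by
  have h := D.finrank_prim_add_finrank_ker_a' 0
  rw [D.gr_zero, bot_inf_eq, finrank_bot, add_zero] at h
  rw [h, finrank_ker_a'_of_finrank_gr hn 0, pow_zero, one_mul]

variable {D} in
theorem finrank_prim_add_two {n : ℕ} (hn : ∀ k, Module.finrank K (D.gr k) + 1 = n ^ k) (j : ℕ) :
    (Module.finrank K (D.prim (j + 2)) : ℝ) = (n : ℝ) ^ j * (n - 1) ^ 2 := by
  have h : ((_ : ℕ) : ℝ) = (_ : ℕ) := congrArg _ (D.finrank_prim_add_finrank_ker_a' (j + 1))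
  rw [finrank_ker_a'_of_finrank_gr hn (j + 1), Nat.cast_add,
    finrank_ker_a'_of_finrank_gr hn j] at h
  rw [eq_sub_of_add_eq h, pow_succ]
  ring

end DoublyCommutingShifts

/-! ### The shifts on functions on finite words -/

namespace CayleyMachine

variable {G : Type*}

/-- `(dropHead f)(x l) = f(l)`, with value `0` at the empty word. -/
def dropHead : Module.End ℝ (List G → ℝ) where
  toFun f
    | [] => 0
    | _ :: l => f l
  map_add' f g := by funext l; cases l <;> simp
  map_smul' c f := by funext l; cases l <;> simp

@[simp] theorem dropHead_nil (f : List G → ℝ) : dropHead f [] = 0 := rfl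
@[simp] theorem dropHead_cons (f : List G → ℝ) (x : G) (l : List G) :
    dropHead f (x :: l) = f l := rfl

/-- The functions supported on the words of length `k`. -/
def level (G : Type*) (k : ℕ) : Submodule ℝ (List G → ℝ) where
  carrier := {f | ∀ l, l.length ≠ k → f l = 0}
  add_mem' hf hg l hl := by simp [hf l hl, hg l hl]
  zero_mem' _ _ := rfl
  smul_mem' c f hf l hl := by simp [hf l hl]

theorem dropHead_mem_level {k : ℕ} {f : List G → ℝ} (hf : f ∈ level G k) :
    dropHead f ∈ level G (k + 1) := by
  rintro (_ | ⟨x, l⟩) hl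
  · rfl
  · exact hf l (by simpa using hl)

/-- The indicator function of the set of words of length `k`. -/
def levelOne (G : Type*) (k : ℕ) : List G → ℝ := fun l => if l.length = k then 1 else 0

theorem levelOne_mem_level (k : ℕ) : levelOne G k ∈ level G k := fun _ hl => if_neg hl

/-- A function supported on the words of length `k` amounts to a function on those words. -/
noncomputable def levelEquiv (G : Type*) (k : ℕ) : level G k ≃ₗ[ℝ] (List.Vector G k → ℝ) where
  toFun f v := f.1 v.1
  map_add' _ _ := rfl
  map_smul' _ _ := rfl
  invFun f := ⟨fun l => if h : l.length = k then f ⟨l, h⟩ else 0, fun _ hl => dif_neg hl⟩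
  left_inv f := by
    refine Subtype.ext (funext fun l => ?_)
    by_cases h : l.length = k
    · exact dif_pos h
    · rw [f.2 l h]; exact dif_neg h
  right_inv f := funext fun v => dif_pos v.2

instance [Finite G] (k : ℕ) : FiniteDimensional ℝ (level G k) :=
  have : Finite (List.Vector G k) := (List.finite_length_eq G k).to_subtype
  (levelEquiv G k).symm.finiteDimensional

section Average

variable [Fintype G]

/-- The average of `f` over all words `y l`, where `y` runs through `G`. -/
noncomputable def avgHead : Module.End ℝ (List G → ℝ) where
  toFun f l := (Fintype.card G : ℝ)⁻¹ * ∑ y, f (y :: l)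
  map_add' f g := by funext l; simp [Finset.sum_add_distrib, mul_add]
  map_smul' c f := by funext l; simp only [Pi.smul_apply, smul_eq_mul, RingHom.id_apply,
    ← Finset.mul_sum]; ring

theorem avgHead_apply (f : List G → ℝ) (l : List G) :
    avgHead f l = (Fintype.card G : ℝ)⁻¹ * ∑ y, f (y :: l) := rfl

/-- The mean value of a function over the words of length `k`. -/
noncomputable def mean (k : ℕ) : (List G → ℝ) →ₗ[ℝ] ℝ :=
  LinearMap.proj ([] : List G) ∘ₗ (avgHead ^ k : Module.End ℝ (List G → ℝ))

theorem mean_apply (k : ℕ) (f : List G → ℝ) : mean k f = (avgHead ^ k) f [] := rfl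

theorem mean_zero (f : List G → ℝ) : mean 0 f = f [] := rfl

theorem mean_succ (k : ℕ) (f : List G → ℝ) : mean (k + 1) f = mean k (avgHead f) := by
  rw [mean_apply, mean_apply, pow_succ, Module.End.mul_apply]

/-- The functions whose mean over the words of each length is zero. They vanish at the empty word,
which is what the commutation of `avgHead` with `dropDiff`, and of `dropHead` with `avgRun`,
requires there. -/
noncomputable def meanZero : Submodule ℝ (List G → ℝ) := ⨅ k, LinearMap.ker (mean k)

theorem mem_meanZero {f : List G → ℝ} : f ∈ meanZero ↔ ∀ k, mean k f = 0 := by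
  simp [meanZero]

theorem apply_nil_of_mem_meanZero {f : List G → ℝ} (hf : f ∈ meanZero) : f [] = 0 :=
  mem_meanZero.1 hf 0

theorem avgHead_mem_meanZero {f : List G → ℝ} (hf : f ∈ meanZero) : avgHead f ∈ meanZero :=
  mem_meanZero.2 fun k => by rw [← mean_succ]; exact mem_meanZero.1 hf _

theorem avgHead_mem_level {k : ℕ} {f : List G → ℝ} (hf : f ∈ level G (k + 1)) :
    avgHead f ∈ level G k := by
  intro l hl
  rw [avgHead_apply, Finset.sum_eq_zero, mul_zero]
  exact fun y _ => hf _ (by simpa using hl)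

theorem mean_eq_zero_of_mem_level {k m : ℕ} (hkm : m ≠ k) {f : List G → ℝ} (hf : f ∈ level G k) :
    mean m f = 0 := by
  induction m generalizing k f with
  | zero => exact hf [] hkm
  | succ m ih =>
    rw [mean_succ]
    cases k with
    | zero =>
      have : avgHead f = 0 := by
        funext l
        rw [avgHead_apply, Finset.sum_eq_zero, mul_zero]; · rfl
        exact fun y _ => hf _ (by simp)
      rw [this, map_zero]
    | succ k => exact ih (by omega) (avgHead_mem_level hf)

theorem level_inf_meanZero (k : ℕ) :
    level G k ⊓ meanZero = level G k ⊓ LinearMap.ker (mean k) := by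
  refine le_antisymm (inf_le_inf le_rfl (iInf_le _ k)) fun f hf => ⟨hf.1, ?_⟩
  refine mem_meanZero.2 fun m => ?_
  by_cases hm : m = k
  · exact hm ▸ hf.2
  · exact mean_eq_zero_of_mem_level hm hf.1

theorem finrank_level (k : ℕ) : Module.finrank ℝ (level G k) = Fintype.card G ^ k := by
  rw [(levelEquiv G k).finrank_eq, Module.finrank_fintype_fun_eq_card, card_vector]

end Average

section Group

variable [Group G]

theorem run_cons (g x : G) (l : List G) :
    (cayleyMachine G).run g (x :: l) = (g * x) :: (cayleyMachine G).run (g * x) l := rfl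

theorem reset_run_cons (g x : G) (l : List G) :
    (resetAutomaton G).run g (x :: l) = (g⁻¹ * x) :: (resetAutomaton G).run x l := rfl

theorem reset_run_run (g : G) (l : List G) :
    (resetAutomaton G).run g ((cayleyMachine G).run g l) = l := by
  rw [← cayleyMachine_perm_inv_apply]
  exact Equiv.symm_apply_apply ((cayleyMachine G).perm (cayleyMachine_isInvertible G) g) l

/-- `(dropDiff f)(x l) = f(u)` where `u` is the output of the reset automaton on `l` in state `x`,
that is, the word of successive quotients of `x l`. The value at the empty word is `0`. -/
def dropDiff : Module.End ℝ (List G → ℝ) where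
  toFun f
    | [] => 0
    | x :: l => f ((resetAutomaton G).run x l)
  map_add' f g := by funext l; cases l <;> simp
  map_smul' c f := by funext l; cases l <;> simp

@[simp] theorem dropDiff_nil (f : List G → ℝ) : dropDiff f [] = 0 := rfl
@[simp] theorem dropDiff_cons (f : List G → ℝ) (x : G) (l : List G) :
    dropDiff f (x :: l) = f ((resetAutomaton G).run x l) := rfl

theorem dropDiff_mem_level {k : ℕ} {f : List G → ℝ} (hf : f ∈ level G k) :
    dropDiff f ∈ level G (k + 1) := by
  rintro (_ | ⟨x, l⟩) hl
  · rfl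
  · exact hf _ (by simpa [MealyAutomaton.length_run] using hl)

theorem commute_dropHead_dropDiff : Commute (dropHead : Module.End ℝ (List G → ℝ)) dropDiff := by
  ext f l
  match l with
  | [] => simp
  | [x] => simp [MealyAutomaton.run]
  | x :: y :: l => simp [reset_run_cons]

variable [Fintype G]

/-- The average of `f` over all words whose word of successive quotients is `l`. -/
noncomputable def avgRun : Module.End ℝ (List G → ℝ) where
  toFun f l := (Fintype.card G : ℝ)⁻¹ * ∑ y, f (y :: (cayleyMachine G).run y l)
  map_add' f g := by funext l; simp [Finset.sum_add_distrib, mul_add]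
  map_smul' c f := by funext l; simp only [Pi.smul_apply, smul_eq_mul, RingHom.id_apply,
    ← Finset.mul_sum]; ring

theorem avgRun_apply (f : List G → ℝ) (l : List G) :
    avgRun f l = (Fintype.card G : ℝ)⁻¹ * ∑ y, f (y :: (cayleyMachine G).run y l) := rfl

theorem avgHead_mul_dropHead : (avgHead : Module.End ℝ (List G → ℝ)) * dropHead = 1 := by
  ext f l
  simp [avgHead_apply]

theorem avgRun_mul_dropDiff : (avgRun : Module.End ℝ (List G → ℝ)) * dropDiff = 1 := by
  ext f l
  simp [avgRun_apply, reset_run_run]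

/-- In both orders the product averages over all words `y z u`, where `u` is the output on `l` in
state `z`. -/
theorem commute_avgHead_avgRun : Commute (avgHead : Module.End ℝ (List G → ℝ)) avgRun := by
  ext f l
  simp only [Module.End.mul_apply, avgHead_apply, avgRun_apply, run_cons, ← Finset.mul_sum]
  congr 2
  rw [Finset.sum_comm]
  conv_rhs => rw [Finset.sum_comm]
  exact Finset.sum_congr rfl fun y _ => Equiv.sum_comp (Equiv.mulLeft y)
    fun z => f (y :: z :: (cayleyMachine G).run z l)

theorem avgHead_dropDiff_cons (f : List G → ℝ) (x : G) (l : List G) :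
    avgHead (dropDiff f) (x :: l) = dropDiff (avgHead f) (x :: l) := by
  simp only [avgHead_apply, dropDiff_cons, reset_run_cons]
  congr 1
  exact ((Equiv.inv G).trans (Equiv.mulRight x)).sum_comp
    fun y => f (y :: (resetAutomaton G).run x l)

theorem avgHead_dropDiff_nil (f : List G → ℝ) : avgHead (dropDiff f) [] = f [] := by
  simp [avgHead_apply, MealyAutomaton.run]

theorem dropHead_avgRun_cons (f : List G → ℝ) (x : G) (l : List G) :
    dropHead (avgRun f) (x :: l) = avgRun (dropHead f) (x :: l) := by
  simp only [avgRun_apply, dropHead_cons, run_cons]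
  congr 1
  exact (Equiv.sum_comp (Equiv.mulRight x) fun y => f (y :: (cayleyMachine G).run y l)).symm

theorem avgRun_dropHead_nil (f : List G → ℝ) : avgRun (dropHead f) [] = f [] := by
  simp [avgRun_apply, MealyAutomaton.run]

theorem avgRun_nil (f : List G → ℝ) : avgRun f [] = avgHead f [] := rfl

theorem mean_avgRun (k : ℕ) (f : List G → ℝ) : mean k (avgRun f) = mean k (avgHead f) := by
  rw [mean_apply, mean_apply, ← Module.End.mul_apply, (commute_avgHead_avgRun.pow_left k).eq,
    Module.End.mul_apply, avgRun_nil, ← Module.End.mul_apply, ← Module.End.mul_apply,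
    (Commute.refl avgHead).pow_left k |>.eq]

theorem avgRun_mem_meanZero {f : List G → ℝ} (hf : f ∈ meanZero) : avgRun f ∈ meanZero :=
  mem_meanZero.2 fun k => by rw [mean_avgRun, ← mean_succ]; exact mem_meanZero.1 hf _

theorem dropHead_mem_meanZero {f : List G → ℝ} (hf : f ∈ meanZero) : dropHead f ∈ meanZero :=
  mem_meanZero.2 fun k => by
    cases k with
    | zero => rfl
    | succ k =>
      rw [mean_succ, ← Module.End.mul_apply, avgHead_mul_dropHead]
      exact mem_meanZero.1 hf k

theorem avgHead_dropDiff {f : List G → ℝ} (hf : f ∈ meanZero) :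
    avgHead (dropDiff f) = dropDiff (avgHead f) := by
  funext l
  cases l with
  | nil => rw [avgHead_dropDiff_nil, apply_nil_of_mem_meanZero hf, dropDiff_nil]
  | cons x l => exact avgHead_dropDiff_cons f x l

theorem dropHead_avgRun {f : List G → ℝ} (hf : f ∈ meanZero) :
    dropHead (avgRun f) = avgRun (dropHead f) := by
  funext l
  cases l with
  | nil => rw [avgRun_dropHead_nil, apply_nil_of_mem_meanZero hf, dropHead_nil]
  | cons x l => exact dropHead_avgRun_cons f x l

theorem dropDiff_mem_meanZero {f : List G → ℝ} (hf : f ∈ meanZero) : dropDiff f ∈ meanZero :=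
  mem_meanZero.2 fun k => by
    induction k generalizing f with
    | zero => rfl
    | succ k ih => rw [mean_succ, avgHead_dropDiff hf]; exact ih (avgHead_mem_meanZero hf)

theorem avgRun_mem_level {k : ℕ} {f : List G → ℝ} (hf : f ∈ level G (k + 1)) :
    avgRun f ∈ level G k := by
  intro l hl
  rw [avgRun_apply, Finset.sum_eq_zero, mul_zero]
  exact fun y _ => hf _ (by simpa [MealyAutomaton.length_run] using hl)

theorem mean_levelOne (k : ℕ) : mean k (levelOne G k) = 1 := by
  induction k with
  | zero => simp [mean_zero, levelOne]
  | succ k ih =>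
    rw [mean_succ, ← ih]
    congr 1
    funext l
    simp [avgHead_apply, levelOne]

theorem finrank_level_inf_meanZero (k : ℕ) :
    Module.finrank ℝ (level G k ⊓ meanZero : Submodule ℝ (List G → ℝ)) + 1 =
      Fintype.card G ^ k := by
  have := Submodule.finrank_inf_ker_add_finrank (p := level G k) (q := ⊤) (mean k)
    (LinearMap.toSpanSingleton ℝ _ (levelOne G k)) (fun _ _ => trivial)
    (fun c _ => Submodule.smul_mem _ c (levelOne_mem_level k))
    (fun c => by simp [mean_levelOne])
  rwa [← level_inf_meanZero, finrank_top, Module.finrank_self, finrank_level] at this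

/-- The doubly commuting shifts on the functions of mean zero on finite words over `G`. -/
noncomputable def shifts (G : Type*) [Group G] [Fintype G] :
    DoublyCommutingShifts ℝ (meanZero : Submodule ℝ (List G → ℝ)) where
  a := dropHead.restrict fun _ => dropHead_mem_meanZero
  b := dropDiff.restrict fun _ => dropDiff_mem_meanZero
  a' := avgHead.restrict fun _ => avgHead_mem_meanZero
  b' := avgRun.restrict fun _ => avgRun_mem_meanZero
  a'_mul_a := by
    refine LinearMap.ext fun f => Subtype.ext ?_
    exact LinearMap.congr_fun avgHead_mul_dropHead f.1
  b'_mul_b := by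
    refine LinearMap.ext fun f => Subtype.ext ?_
    exact LinearMap.congr_fun avgRun_mul_dropDiff f.1
  comm_a_b := by
    refine LinearMap.ext fun f => Subtype.ext ?_
    exact LinearMap.congr_fun commute_dropHead_dropDiff.eq f.1
  comm_a'_b' := by
    refine LinearMap.ext fun f => Subtype.ext ?_
    exact LinearMap.congr_fun commute_avgHead_avgRun.eq f.1
  comm_a'_b := LinearMap.ext fun f => Subtype.ext (avgHead_dropDiff f.2)
  comm_a_b' := LinearMap.ext fun f => Subtype.ext (dropHead_avgRun f.2)
  gr k := (level G k).comap meanZero.subtype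
  gr_zero := by
    refine (Submodule.eq_bot_iff _).2 fun f hf => Subtype.ext (funext fun l => ?_)
    cases l with
    | nil => exact apply_nil_of_mem_meanZero f.2
    | cons x l => exact hf (x :: l) (by simp)
  a_mem := dropHead_mem_level
  b_mem := dropDiff_mem_level
  a'_mem := avgHead_mem_level
  b'_mem := avgRun_mem_level
  finite k :=
     Module.Finite.of_injective
      (meanZero.subtype.restrict (p := (level G k).comap meanZero.subtype) (q := level G k)
        fun _ hf => hf)
      fun f g h => Subtype.ext (Subtype.ext (congrArg (Subtype.val : level G k → List G → ℝ) h))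

theorem mem_gr {k : ℕ} {f : (meanZero : Submodule ℝ (List G → ℝ))} :
    f ∈ (shifts G).gr k ↔ (f : List G → ℝ) ∈ level G k := Iff.rfl

theorem finrank_gr (k : ℕ) : Module.finrank ℝ ((shifts G).gr k) + 1 = Fintype.card G ^ k := by
  rw [← finrank_level_inf_meanZero, ← Submodule.finrank_map_subtype_eq]
  change Module.finrank ℝ (((level G k).comap meanZero.subtype).map meanZero.subtype :) + 1 = _
  rw [Submodule.map_comap_subtype, inf_comm]

end Group

end CayleyMachine

/-! ### The action of the automaton group on words -/

namespace CayleyMachine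

section Action

variable {G : Type*} [Group G]

/-- The state `g` of the Cayley machine as an element of the automaton group. -/
noncomputable abbrev state (g : G) :
    (cayleyMachine G).automataGroup (cayleyMachine_isInvertible G) :=
  (cayleyMachine G).gen (cayleyMachine_isInvertible G) g

theorem state_smul (g : G) (l : List G) : state g • l = (cayleyMachine G).run g l := rfl

theorem state_inv_smul (g : G) (l : List G) : (state g)⁻¹ • l = (resetAutomaton G).run g l :=
  cayleyMachine_perm_inv_apply G g l

/-- The element `𝒞₁⁻¹ 𝒞_g` multiplies the first letter by `g` and fixes the others. -/
theorem state_one_inv_mul_state_smul (g x : G) (l : List G) :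
    ((state (1 : G))⁻¹ * state g) • (x :: l) = (g * x) :: l := by
  rw [mul_smul, state_smul, state_inv_smul, run_cons, reset_run_cons, reset_run_run, inv_one,
    one_mul]

/-- Every element of the automaton group is the restriction to the subtree at the word `1` of some
element fixing that word. -/
theorem exists_smul_one_cons (γ : (cayleyMachine G).automataGroup (cayleyMachine_isInvertible G)) :
    ∃ γ' : (cayleyMachine G).automataGroup (cayleyMachine_isInvertible G),
      ∀ l : List G, γ' • ((1 : G) :: l) = 1 :: γ • l := by
  obtain ⟨σ, hσ⟩ := γ
  induction hσ using Subgroup.closure_induction with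
  | mem σ h =>
    obtain ⟨g, rfl⟩ := h
    refine ⟨((state 1)⁻¹ * state g⁻¹) * state g, fun l => ?_⟩
    rw [mul_smul, state_smul, run_cons, mul_one, state_one_inv_mul_state_smul, inv_mul_cancel]
    rfl
  | one => exact ⟨1, fun l => by rw [one_smul]; rfl⟩
  | mul σ τ hσ hτ h1 h2 =>
    obtain ⟨γ₁, h1⟩ := h1
    obtain ⟨γ₂, h2⟩ := h2
    exact ⟨γ₁ * γ₂, fun l => by rw [mul_smul, h2, h1]; rfl⟩
  | inv σ hσ h =>
    obtain ⟨γ', h⟩ := h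
    refine ⟨γ'⁻¹, fun l => ?_⟩
    rw [inv_smul_eq_iff, h]
    exact congrArg _ (Equiv.apply_symm_apply σ l).symm

/-- The automaton group acts transitively on the words of each length. -/
theorem exists_smul_eq_of_length_eq {u v : List G} (h : u.length = v.length) :
    ∃ γ : (cayleyMachine G).automataGroup (cayleyMachine_isInvertible G), γ • u = v := by
  have key : ∀ l : List G, ∃ γ : (cayleyMachine G).automataGroup (cayleyMachine_isInvertible G),
      γ • l = List.replicate l.length 1 := by
    intro l
    induction l with
    | nil => exact ⟨1, one_smul _ _⟩
    | cons x l ih =>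
      obtain ⟨γ, hγ⟩ := ih
      obtain ⟨γ', hγ'⟩ := exists_smul_one_cons γ
      refine ⟨γ' * ((state 1)⁻¹ * state x⁻¹), ?_⟩
      rw [mul_smul, state_one_inv_mul_state_smul, inv_mul_cancel, hγ', hγ]
      rfl
  obtain ⟨γ, hγ⟩ := key u
  obtain ⟨δ, hδ⟩ := key v
  exact ⟨δ⁻¹ * γ, by rw [mul_smul, hγ, h, ← hδ, inv_smul_smul]⟩

theorem state_injective : Function.Injective (state : G → _) := by
  intro g h hgh
  have : state g • [(1 : G)] = state h • [(1 : G)] := by rw [hgh]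
  simp only [state_smul, run_cons, mul_one, List.cons.injEq] at this
  exact this.1

/-- No state is the inverse of a state: this is visible on the words `x 1 1`. -/
theorem state_ne_inv_state [Nontrivial G] (g h : G) : state g ≠ (state h)⁻¹ := by
  intro hgh
  obtain ⟨x, hx⟩ := exists_ne (1 : G)
  have key : ∀ y : G, g * y * 1 = 1 := by
    intro y
    have : state g • [y, 1, 1] = (state h)⁻¹ • [y, (1 : G), 1] := by rw [hgh]
    simp only [state_smul, state_inv_smul, run_cons, reset_run_cons, List.cons.injEq] at this
    simpa using this.2.2.1
  refine hx ?_
  have h1 := key 1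
  have h2 := key x
  simp only [mul_one] at h1 h2
  simpa [h1] using h2

/-- The states and their inverses are `2 |G|` different elements. -/
noncomputable def sumEquivSymmGens (G : Type*) [Group G] [Nontrivial G] :
    G ⊕ G ≃ (cayleyMachine G).symmGens (cayleyMachine_isInvertible G) :=
  Equiv.ofBijective
    (Sum.elim (fun g => ⟨state g, Or.inl ⟨g, rfl⟩⟩) fun g => ⟨(state g)⁻¹, Or.inr ⟨g, rfl⟩⟩) <| by
    constructor
    · rintro (g | g) (h | h) hgh
      · exact congrArg _ (state_injective (congrArg Subtype.val hgh))
      · exact absurd (congrArg Subtype.val hgh) (state_ne_inv_state g h)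
      · exact absurd (congrArg Subtype.val hgh).symm (state_ne_inv_state h g)
      · exact congrArg _ (state_injective (inv_injective (congrArg Subtype.val hgh)))
    · rintro ⟨s, ⟨g, rfl⟩ | ⟨g, rfl⟩⟩
      · exact ⟨Sum.inl g, rfl⟩
      · exact ⟨Sum.inr g, rfl⟩

end Action

/-! ### The Markov operator on functions on words -/

section Walk

variable {G : Type*} [Group G] [Fintype G]

/-- The average of `f` over the images of a word under the states and their inverses. -/
noncomputable def walk : Module.End ℝ (List G → ℝ) where
  toFun f l := (2 * Fintype.card G : ℝ)⁻¹ *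
    (∑ g, f ((cayleyMachine G).run g l) + ∑ g, f ((resetAutomaton G).run g l))
  map_add' f g := by funext l; simp only [Pi.add_apply, Finset.sum_add_distrib]; ring
  map_smul' c f := by
    funext l
    simp only [Pi.smul_apply, smul_eq_mul, RingHom.id_apply, ← Finset.mul_sum]
    ring

theorem walk_apply (f : List G → ℝ) (l : List G) :
    walk f l = (2 * Fintype.card G : ℝ)⁻¹ *
      (∑ g, f ((cayleyMachine G).run g l) + ∑ g, f ((resetAutomaton G).run g l)) := rfl

/-- On functions of mean zero the walk is half the hopping operator. -/
theorem two_smul_walk (f : (meanZero : Submodule ℝ (List G → ℝ))) :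
    (2 : ℝ) • walk (f : List G → ℝ) = ((shifts G).hop f : List G → ℝ) := by
  have hop_eq : ((shifts G).hop f : List G → ℝ) =
      dropDiff (avgHead (f : List G → ℝ)) + dropHead (avgRun (f : List G → ℝ)) := rfl
  rw [hop_eq]
  funext l
  cases l with
  | nil =>
    simp [walk_apply, MealyAutomaton.run, apply_nil_of_mem_meanZero f.2]
  | cons x l =>
    simp only [Pi.smul_apply, smul_eq_mul, walk_apply, Pi.add_apply, dropDiff_cons, dropHead_cons,
      avgHead_apply, avgRun_apply, run_cons, reset_run_cons]
    have h1 := Equiv.sum_comp (Equiv.mulRight x) fun y => f.1 (y :: (cayleyMachine G).run y l)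
    have h2 := Equiv.sum_comp ((Equiv.inv G).trans (Equiv.mulRight x))
      fun y => f.1 (y :: (resetAutomaton G).run x l)
    simp only [Equiv.coe_mulRight, Equiv.trans_apply, Equiv.inv_apply] at h1 h2
    rw [h1, h2, mul_inv]
    ring

theorem mean_comp_run (k : ℕ) (g : G) (f : List G → ℝ) :
    mean k (fun l => f ((cayleyMachine G).run g l)) = mean k f := by
  cases k with
  | zero => rfl
  | succ k =>
    rw [mean_succ, mean_succ, ← mean_avgRun k f]
    congr 1
    funext l
    rw [avgHead_apply, avgRun_apply]
    congr 1
    exact Equiv.sum_comp (Equiv.mulLeft g) fun y => f (y :: (cayleyMachine G).run y l)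

theorem mean_comp_reset_run (k : ℕ) (g : G) (f : List G → ℝ) :
    mean k (fun l => f ((resetAutomaton G).run g l)) = mean k f := by
  rw [← mean_comp_run k g]
  simp only [reset_run_run]

theorem mean_walk (k : ℕ) (f : List G → ℝ) : mean k (walk f) = mean k f := by
  have h : walk f = (2 * Fintype.card G : ℝ)⁻¹ •
      (∑ g, (fun l => f ((cayleyMachine G).run g l)) +
        ∑ g, fun l => f ((resetAutomaton G).run g l)) := by
    funext l
    simp [walk_apply]
  have hc : (Fintype.card G : ℝ) ≠ 0 := by exact_mod_cast Fintype.card_ne_zero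
  rw [h, map_smul, map_add, map_sum, map_sum]
  simp only [mean_comp_run, mean_comp_reset_run, Finset.sum_const, Finset.card_univ, smul_eq_mul,
    nsmul_eq_mul]
  field_simp
  ring

theorem walk_levelOne (k : ℕ) : walk (levelOne G k) = levelOne G k := by
  have hc : (Fintype.card G : ℝ) ≠ 0 := by exact_mod_cast Fintype.card_ne_zero
  funext l
  simp only [walk_apply, levelOne, MealyAutomaton.length_run, Finset.sum_const, Finset.card_univ,
    nsmul_eq_mul]
  field_simp
  norm_num

end Walk

/-! ### The Schreier graphs -/

section Schreier

variable {G : Type*} [Group G]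

/-- The vertices of the Schreier graph of the stabilizer of a word of length `k`. -/
abbrev Vertex (w : ℕ → G) (k : ℕ) : Type _ :=
  (cayleyMachine G).automataGroup (cayleyMachine_isInvertible G) ⧸
    (cayleyMachine G).prefixStabilizer (cayleyMachine_isInvertible G) w k

/-- The coset `γ P_k` corresponds to the image under `γ` of the prefix of `w` of length `k`. -/
noncomputable def word (w : ℕ → G) (k : ℕ) : Vertex w k → List G :=
  MulAction.ofQuotientStabilizer _ (List.ofFn fun i : Fin k => w i)

variable {w : ℕ → G} {k : ℕ}

theorem word_injective : Function.Injective (word w k) :=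
  MulAction.injective_ofQuotientStabilizer _ _

theorem word_smul (γ : (cayleyMachine G).automataGroup (cayleyMachine_isInvertible G))
    (v : Vertex w k) : word w k (γ • v) = γ • word w k v :=
  MulAction.ofQuotientStabilizer_smul _ _ γ v

theorem length_word (v : Vertex w k) : (word w k v).length = k := by
  induction v using QuotientGroup.induction_on with
  | H γ =>
    change (γ • List.ofFn fun i : Fin k => w i).length = k
    rw [MealyAutomaton.length_smul, List.length_ofFn]

theorem exists_word_eq {l : List G} (hl : l.length = k) : ∃ v : Vertex w k, word w k v = l := by
  obtain ⟨γ, hγ⟩ := exists_smul_eq_of_length_eq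
    (u := List.ofFn fun i : Fin k => w i) (v := l) (by rw [List.length_ofFn, hl])
  exact ⟨QuotientGroup.mk γ, hγ⟩

/-- Restriction of functions on words to the vertices of the Schreier graph. -/
noncomputable def pull (w : ℕ → G) (k : ℕ) : (List G → ℝ) →ₗ[ℝ] (Vertex w k → ℝ) :=
  LinearMap.funLeft ℝ ℝ (word w k)

theorem pull_apply (f : List G → ℝ) (v : Vertex w k) : pull w k f v = f (word w k v) := rfl

theorem eq_of_pull_eq {f g : List G → ℝ} (hf : f ∈ level G k) (hg : g ∈ level G k)
    (h : pull w k f = pull w k g) : f = g := by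
  funext l
  by_cases hl : l.length = k
  · obtain ⟨v, rfl⟩ := exists_word_eq (w := w) hl
    exact congrFun h v
  · rw [hf l hl, hg l hl]

theorem exists_pull_eq (φ : Vertex w k → ℝ) : ∃ f ∈ level G k, pull w k f = φ := by
  classical
  refine ⟨fun l => if h : l.length = k then φ (exists_word_eq h).choose else 0,
    fun l hl => dif_neg hl, funext fun v => ?_⟩
  rw [pull_apply, dif_pos (length_word v)]
  exact congrArg φ (word_injective (exists_word_eq (length_word v)).choose_spec)

variable [Fintype G]

theorem walk_mem_level {f : List G → ℝ} (hf : f ∈ level G k) : walk f ∈ level G k := by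
  intro l hl
  rw [walk_apply, Finset.sum_eq_zero, Finset.sum_eq_zero, add_zero, mul_zero]
  all_goals exact fun g _ => hf _ (by rwa [MealyAutomaton.length_run])

theorem mem_eigen_iff {lam : ℝ} {f : (meanZero : Submodule ℝ (List G → ℝ))} :
    f ∈ (shifts G).eigen k lam ↔
      (f : List G → ℝ) ∈ level G k ∧ walk (f : List G → ℝ) = lam • (f : List G → ℝ) := by
  rw [DoublyCommutingShifts.mem_eigen, mem_gr, Subtype.ext_iff, ← two_smul_walk,
    Submodule.coe_smul, mul_smul]
  exact and_congr_right fun _ => (smul_right_injective _ (two_ne_zero' ℝ)).eq_iff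

variable [Nontrivial G]

theorem cayleyMarkov_pull (f : List G → ℝ) :
    cayleyMarkov G w k (pull w k f) = pull w k (walk f) := by
  funext v
  rw [cayleyMarkov, markov_schreierGraph_apply, ← Nat.card_congr (sumEquivSymmGens G),
    ← finsum_comp_equiv (sumEquivSymmGens G), finsum_eq_sum_of_fintype, Fintype.sum_sum_type,
    Nat.card_eq_fintype_card, Fintype.card_sum, pull_apply, walk_apply]
  simp only [pull_apply, word_smul]
  push_cast
  rw [two_mul]
  congr 2
  refine Finset.sum_congr rfl fun g _ => ?_
  rw [← state_inv_smul]
  rfl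

theorem mem_eigenspace_pull_iff {lam : ℝ} {f : List G → ℝ} (hf : f ∈ level G k) :
    pull w k f ∈ Module.End.eigenspace (cayleyMarkov G w k) lam ↔ walk f = lam • f := by
  rw [Module.End.mem_eigenspace_iff, cayleyMarkov_pull, ← map_smul]
  exact ⟨eq_of_pull_eq (walk_mem_level hf) (Submodule.smul_mem _ _ hf), congrArg _⟩

/-- An eigenvector for an eigenvalue other than `1` has mean zero, because the walk preserves the
mean. -/
theorem finrank_eigenspace_of_ne_one {lam : ℝ} (hlam : lam ≠ 1) :
    Module.finrank ℝ (Module.End.eigenspace (cayleyMarkov G w k) lam) =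
      Module.finrank ℝ ((shifts G).eigen k lam) := by
  let ψ : (shifts G).eigen k lam →ₗ[ℝ] (Vertex w k → ℝ) :=
    pull w k ∘ₗ meanZero.subtype ∘ₗ ((shifts G).eigen k lam).subtype
  have hψ : Function.Injective ψ := fun f g h => Subtype.ext (Subtype.ext
    (eq_of_pull_eq (mem_eigen_iff.1 f.2).1 (mem_eigen_iff.1 g.2).1 h))
  rw [← LinearMap.finrank_range_of_inj hψ]
  suffices h : Module.End.eigenspace (cayleyMarkov G w k) lam = LinearMap.range ψ by rw [h]
  ext φ
  constructor
  · intro hφ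
    obtain ⟨f, hf, rfl⟩ := exists_pull_eq φ
    have hw := (mem_eigenspace_pull_iff hf).1 hφ
    have hm : mean k f = 0 := by
      have h := mean_walk k f
      rw [hw, map_smul, smul_eq_mul] at h
      have : (lam - 1) * mean k f = 0 := by linear_combination h
      exact (mul_eq_zero.1 this).resolve_left (sub_ne_zero.2 hlam)
    have h0 : f ∈ level G k ⊓ meanZero := by
      rw [level_inf_meanZero]
      exact ⟨hf, hm⟩
    exact ⟨⟨⟨f, h0.2⟩, mem_eigen_iff.2 ⟨hf, hw⟩⟩, rfl⟩
  · rintro ⟨f, rfl⟩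
    obtain ⟨hf, hw⟩ := mem_eigen_iff.1 f.2
    exact (mem_eigenspace_pull_iff hf).2 hw

/-- The eigenvectors for the eigenvalue `1` are the constants, because `U m` does not vanish
at `1`. -/
theorem finrank_eigenspace_one :
    Module.finrank ℝ (Module.End.eigenspace (cayleyMarkov G w k) 1) = 1 := by
  have hbot : (shifts G).eigen k 1 = ⊥ := by
    have : FiniteDimensional ℝ ((shifts G).eigen k 1) :=
      Submodule.finiteDimensional_of_le (inf_le_left : _ ≤ (shifts G).gr k)
    rw [← Submodule.finrank_eq_zero (R := ℝ), DoublyCommutingShifts.finrank_eigen,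
      Finset.filter_false_of_mem, Finset.sum_empty]
    intro r _ h
    rw [Polynomial.Chebyshev.U_eval_one] at h
    exact absurd h (by push_cast; positivity)
  have hspan : Module.End.eigenspace (cayleyMarkov G w k) 1 =
      Submodule.span ℝ {pull w k (levelOne G k)} := by
    refine le_antisymm (fun φ hφ => ?_) ?_
    · obtain ⟨f, hf, rfl⟩ := exists_pull_eq φ
      have hw := (mem_eigenspace_pull_iff hf).1 hφ
      rw [one_smul] at hw
      have hl : f - mean k f • levelOne G k ∈ level G k :=
        sub_mem hf (Submodule.smul_mem _ _ (levelOne_mem_level k))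
      have h0 : f - mean k f • levelOne G k ∈ level G k ⊓ meanZero := by
        rw [level_inf_meanZero]
        exact ⟨hl, by simp [mean_levelOne]⟩
      have hmem : (⟨_, h0.2⟩ : (meanZero : Submodule ℝ (List G → ℝ))) ∈ (shifts G).eigen k 1 :=
        mem_eigen_iff.2 ⟨hl, by rw [map_sub, map_smul, hw, walk_levelOne, one_smul]⟩
      rw [hbot, Submodule.mem_bot, Subtype.ext_iff] at hmem
      rw [sub_eq_zero.1 hmem, map_smul]
      exact Submodule.smul_mem _ _ (Submodule.mem_span_singleton_self _)
    · rw [Submodule.span_singleton_le_iff_mem, mem_eigenspace_pull_iff (levelOne_mem_level k),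
        walk_levelOne, one_smul]
  rw [hspan, finrank_span_singleton]
  intro h
  have h1 := eq_of_pull_eq (levelOne_mem_level k) (zero_mem _) (h.trans (map_zero _).symm)
  have := mean_levelOne (G := G) k
  rw [h1, map_zero] at this
  exact zero_ne_one this

end Schreier

end CayleyMachine

/-! ### The values of the multiplicities -/

namespace CayleyMachine

open Real Polynomial.Chebyshev

theorem eval_U_cos_eq_zero_iff {p q : ℕ} (hp : 1 ≤ p) (hpq : p < q) (hc : p.Coprime q) (r : ℕ) :
    (U ℝ ((r + 1 : ℕ) : ℤ)).eval (cos ((p : ℝ) / q * π)) = 0 ↔ q ∣ r + 2 := by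
  have hq : (0 : ℝ) < q := by exact_mod_cast (by omega : 0 < q)
  have hsin : sin ((p : ℝ) / q * π) ≠ 0 := by
    refine (sin_pos_of_pos_of_lt_pi (by positivity) ?_).ne'
    refine mul_lt_of_lt_one_left pi_pos ?_
    rw [div_lt_one hq]
    exact_mod_cast hpq
  have hU := U_real_cos ((p : ℝ) / q * π) ((r + 1 : ℕ) : ℤ)
  rw [← mul_left_inj' hsin, zero_mul, hU, sin_eq_zero_iff]
  have key : ∀ m : ℤ, (m : ℝ) * π = ((((r + 1 : ℕ) : ℤ) : ℝ) + 1) * ((p : ℝ) / q * π) ↔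
      (q : ℤ) * m = ((r + 2) * p : ℕ) := by
    intro m
    rw [← Int.cast_inj (α := ℝ)]
    push_cast
    have hpi := pi_ne_zero
    field_simp
    constructor <;> intro h <;> linear_combination h
  simp only [key]
  constructor
  · rintro ⟨m, hm⟩
    have : (q : ℤ) ∣ ((r + 2) * p : ℕ) := ⟨m, hm.symm⟩
    exact (Nat.Coprime.dvd_of_dvd_mul_right hc.symm (Int.natCast_dvd_natCast.1 this))
  · rintro ⟨m, hm⟩
    exact ⟨m * p, by rw [hm]; push_cast; ring⟩

/-- The zeros of `U (r + 1)`. -/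
theorem eval_U_eq_zero_iff (r : ℕ) (x : ℝ) :
    (U ℝ ((r + 1 : ℕ) : ℤ)).eval x = 0 ↔
      ∃ p : ℕ, 1 ≤ p ∧ p < r + 2 ∧ x = cos ((p : ℝ) / ((r + 2 : ℕ) : ℝ) * π) := by
  have hU : U ℝ ((r + 1 : ℕ) : ℤ) ≠ 0 := U_ne_zero ℝ _ (by omega)
  rw [← Polynomial.IsRoot.def, ← Polynomial.mem_roots hU, roots_U_real, Finset.mem_val,
    Finset.mem_image]
  constructor
  · rintro ⟨i, hi, rfl⟩
    refine ⟨i + 1, by omega, by have := Finset.mem_range.1 hi; omega, ?_⟩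
    congr 1
    push_cast
    ring
  · rintro ⟨p, hp, hpr, rfl⟩
    obtain ⟨i, rfl⟩ := Nat.exists_eq_add_of_le' hp
    refine ⟨i, Finset.mem_range.2 (by omega), ?_⟩
    congr 1
    push_cast
    ring

theorem sum_range_ite_dvd_pow (q : ℕ) (x : ℝ) (k : ℕ) :
    ∑ s ∈ Finset.range (k + 1), (if q ∣ s then x ^ s else 0) =
      ∑ t ∈ Finset.range (k / q + 1), (x ^ q) ^ t := by
  induction k with
  | zero => simp
  | succ k ih =>
    rw [Finset.sum_range_succ, ih, Nat.succ_div]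
    by_cases h : q ∣ k + 1
    · rw [if_pos h, if_pos h, Finset.sum_range_succ _ (k / q + 1), ← pow_mul]
      have := Nat.div_mul_cancel h
      rw [Nat.succ_div, if_pos h] at this
      rw [mul_comm q, this]
    · simp [h]

/-- The number of primitive vectors in the degrees `k - r` with `q ∣ r + 2`, as a geometric sum. -/
theorem sum_finrank_prim {H : Type*} [AddCommGroup H] [Module ℝ H] (D : DoublyCommutingShifts ℝ H)
    {n : ℕ} (hn2 : 2 ≤ n) (hn : ∀ k, Module.finrank ℝ (D.gr k) + 1 = n ^ k) {q : ℕ} (hq : 2 ≤ q)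
    (k : ℕ) :
    ∑ r ∈ (Finset.range k).filter (fun r : ℕ => q ∣ r + 2),
      (Module.finrank ℝ (D.prim (k - r)) : ℝ) =
      (n : ℝ) ^ k * ((n : ℝ) - 1) ^ 2 *
          ((1 - (n : ℝ) ^ (-((q * (k / q + 1) : ℕ) : ℤ))) / (1 - (n : ℝ) ^ (-(q : ℤ))) - 1) +
        ((n : ℝ) - 1) * (if q ∣ k + 1 then 1 else 0) := by
  have hn0 : (n : ℝ) ≠ 0 := by positivity
  set x : ℝ := (n : ℝ)⁻¹ with hx
  have hx1 : x ^ q < 1 := pow_lt_one₀ (by positivity)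
    (inv_lt_one_of_one_lt₀ (by exact_mod_cast hn2)) (by omega)
  have hgeom : (1 - (n : ℝ) ^ (-((q * (k / q + 1) : ℕ) : ℤ))) / (1 - (n : ℝ) ^ (-(q : ℤ))) =
      ∑ s ∈ Finset.range (k + 1), (if q ∣ s then x ^ s else 0) := by
    rw [sum_range_ite_dvd_pow, geom_sum_eq hx1.ne, zpow_neg, zpow_neg, zpow_natCast,
      zpow_natCast, ← inv_pow, ← inv_pow, ← hx, ← pow_mul, ← neg_div_neg_eq, neg_sub, neg_sub]
  rw [hgeom, Finset.sum_filter]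
  cases k with
  | zero =>
    have : ¬ q ∣ 1 := fun h => by have := Nat.le_of_dvd one_pos h; omega
    simp [this]
  | succ m =>
    have h1 : ¬ q ∣ 1 := fun h => by have := Nat.le_of_dvd one_pos h; omega
    rw [Finset.sum_range_succ, Finset.sum_range_succ' _ (m + 1), Finset.sum_range_succ' _ m,
      Nat.add_sub_cancel_left, DoublyCommutingShifts.finrank_prim_one hn]
    simp only [zero_add, h1, if_false, dvd_zero, if_true, pow_zero, add_zero, add_sub_cancel_right]
    rw [Finset.mul_sum, mul_ite, mul_one, mul_zero]
    congr 1
    refine Finset.sum_congr rfl fun r hr => ?_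
    have hr := Finset.mem_range.1 hr
    obtain ⟨j, rfl⟩ := Nat.exists_eq_add_of_lt hr
    rw [mul_ite, mul_zero]
    refine if_congr Iff.rfl ?_ rfl
    rw [show r + j + 1 + 1 - r = j + 2 by omega, DoublyCommutingShifts.finrank_prim_add_two hn j,
      hx, show r + j + 1 + 1 = j + (r + 1 + 1) by ring, pow_add (n : ℝ) j, inv_pow]
    field_simp

end CayleyMachine

open CayleyMachine in
theorem mainTheorem4 (G : Type*) [Group G] [Finite G] [Nontrivial G]
    (n : ℕ) (hn : Nat.card G = n) (w : ℕ → G) (k : ℕ) :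
    spectrum ℝ (cayleyMarkov G w k) =
      {1} ∪ {x : ℝ | ∃ p q : ℕ, 2 ≤ q ∧ q ≤ k + 1 ∧ 1 ≤ p ∧ p < q ∧
        x = Real.cos ((p : ℝ) / (q : ℝ) * Real.pi)} ∧
    Module.finrank ℝ (Module.End.eigenspace (cayleyMarkov G w k) 1) = 1 ∧
    ∀ p q : ℕ, 1 ≤ p → p < q → Nat.Coprime p q →
      (Module.finrank ℝ (Module.End.eigenspace (cayleyMarkov G w k)
          (Real.cos ((p : ℝ) / (q : ℝ) * Real.pi))) : ℝ) =
        if q = k + 1 then (n : ℝ) - 1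
        else
          (n : ℝ) ^ k * ((n : ℝ) - 1) ^ 2 *
              ((1 - (n : ℝ) ^ (-((q * (k / q + 1) : ℕ) : ℤ))) / (1 - (n : ℝ) ^ (-(q : ℤ))) - 1) +
            ((n : ℝ) - 1) * (if q ∣ k + 1 then 1 else 0) := by
  have := Fintype.ofFinite G
  have hn2 : 2 ≤ n := by rw [← hn]; exact Finite.one_lt_card
  have hgr : ∀ k, Module.finrank ℝ ((shifts G).gr k) + 1 = n ^ k := fun k => by
    rw [finrank_gr, ← hn, Nat.card_eq_fintype_card]
  have hn1 : (0 : ℝ) < (n : ℝ) - 1 := sub_pos.2 (by exact_mod_cast hn2)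
  refine ⟨?_, finrank_eigenspace_one, fun p q hp hpq hc => ?_⟩
  · ext x
    rw [← Module.End.hasEigenvalue_iff_mem_spectrum, Module.End.hasEigenvalue_iff, Ne,
      ← Submodule.finrank_eq_zero (R := ℝ), Set.mem_union, Set.mem_singleton_iff]
    by_cases hx : x = 1
    · subst hx
      simp [finrank_eigenspace_one]
    · have hprim : ∀ j, 1 ≤ j → Module.finrank ℝ ((shifts G).prim j) ≠ 0 := by
        intro j hj
        rw [← Nat.cast_ne_zero (R := ℝ)]
        rcases hj.eq_or_lt with rfl | hj
        · rw [DoublyCommutingShifts.finrank_prim_one hgr]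
          exact hn1.ne'
        · obtain ⟨i, rfl⟩ := Nat.exists_eq_add_of_le' hj
          rw [DoublyCommutingShifts.finrank_prim_add_two hgr]
          positivity
      rw [finrank_eigenspace_of_ne_one hx, DoublyCommutingShifts.finrank_eigen,
        Finset.sum_eq_zero_iff, or_iff_right hx, Set.mem_ofPred_eq]
      push Not
      constructor
      · rintro ⟨r, hr, -⟩
        rw [Finset.mem_filter, Finset.mem_range, eval_U_eq_zero_iff] at hr
        obtain ⟨hrk, p, hp, hpr, rfl⟩ := hr
        exact ⟨p, r + 2, by omega, by omega, hp, hpr, rfl⟩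
      · rintro ⟨p, q, hq, hqk, hp, hpq, rfl⟩
        obtain ⟨r, rfl⟩ := Nat.exists_eq_add_of_le' hq
        refine ⟨r, ?_, hprim _ (by omega)⟩
        rw [Finset.mem_filter, Finset.mem_range, eval_U_eq_zero_iff]
        exact ⟨by omega, p, hp, hpq, rfl⟩
  · have hcos : Real.cos ((p : ℝ) / q * Real.pi) ≠ 1 := by
      have hq : (0 : ℝ) < q := by exact_mod_cast (by omega : 0 < q)
      have h1 : (p : ℝ) / q < 1 := by rw [div_lt_one hq]; exact_mod_cast hpq
      have h2 : 0 < (p : ℝ) / q * Real.pi := by positivity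
      have h3 : (p : ℝ) / q * Real.pi < Real.pi := mul_lt_of_lt_one_left Real.pi_pos h1
      rw [Ne, Real.cos_eq_one_iff_of_lt_of_lt (by linarith) (by linarith)]
      exact h2.ne'
    rw [finrank_eigenspace_of_ne_one hcos, DoublyCommutingShifts.finrank_eigen]
    simp only [eval_U_cos_eq_zero_iff hp hpq hc]
    rw [Nat.cast_sum, sum_finrank_prim _ hn2 hgr (by omega)]
    by_cases hq : q = k + 1
    · -- For `q = k + 1` the geometric sum has the single term `1`.
      have h1 : (n : ℝ) ^ (-(q : ℤ)) < 1 :=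
        zpow_lt_one_of_neg₀ (by exact_mod_cast hn2) (by omega)
      rw [if_pos hq, if_pos (dvd_of_eq hq), Nat.div_eq_of_lt (by omega), zero_add, mul_one,
        div_self (sub_pos.2 h1).ne', sub_self, mul_zero, zero_add, mul_one]
    · rw [if_neg hq]
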